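/- Let $a,b,c$ be non-negative integers. A plane partition in an $a\times b\times c$ box is a set $T$ of unit cubes of the box $[0,a]\times[0,b]\times[0,c]$, with each cube named by its coordinates $(i,j,k)$, $0\le i<a$, $0\le j<b$, $0\le k<c$, such that $(i,j,k)\in T$ and $i'\le i$, $j'\le j$, $k'\le k$ imply $(i',j',k')\in T$. Let $|T|$ be the number of cubes of $T$. The complement $\kappa(T)$ is obtained by taking the cubes of the box that are not in $T$ and reversing all three coordinates: $$\kappa(T)=\{(a-1-i,\;b-1-j,\;c-1-k) : (i,j,k)\notin T\}.$$ **Theorem.** Let $\Bbbk$ be a field of characteristic different from $2$ (for example $\mathbb{C}$), and let $V$ be a vector space over $\Bbbk$ with a basis $(e_T)$ indexed by the plane partitions $T$ in an $a\times b\times c$ box. Then the linear map $V\to V$ determined by $e_T\mapsto e_{\kappa(T)}$ is conjugate, by an invertible linear map $g:V\to V$, to the linear map determined by $e_T\mapsto(-1)^{|T|}e_T$, which negates exactly the basis vectors of plane partitions with an odd number of cubes. -/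

import Mathlib

/-- A plane partition in an `a × b × c` box: a set of unit cubes of the box (a cube is named by
its corner nearest the origin) that is closed under moving towards the origin, i.e. a lower set
for the coordinatewise order. -/
@[ext]
structure PlanePartition (a b c : ℕ) where
  cubes : Finset (Fin a × Fin b × Fin c)
  isLowerSet : IsLowerSet (cubes : Set (Fin a × Fin b × Fin c))

namespace PlanePartition

/-- Reversal of all three coordinates of the box. -/
def revCube {a b c : ℕ} (x : Fin a × Fin b × Fin c) : Fin a × Fin b × Fin c :=
  (x.1.rev, x.2.1.rev, x.2.2.rev)

/-- Complementation: take all cubes of the box that are not in `T` and reverse all three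
coordinates. -/
def complement {a b c : ℕ} (T : PlanePartition a b c) : PlanePartition a b c where
  cubes := (T.cubesᶜ).image revCube
  isLowerSet := by
    intro x y hyx hx
    simp only [Finset.coe_image, Finset.coe_compl, Set.mem_image, Set.mem_compl_iff,
      Finset.mem_coe] at hx ⊢
    obtain ⟨z, hz, rfl⟩ := hx
    refine ⟨revCube y, fun h => hz ?_, by simp [revCube]⟩
    have hle : z ≤ revCube y := by
      obtain ⟨h1, h2, h3⟩ := hyx
      exact ⟨Fin.le_rev_iff.2 h1, Fin.le_rev_iff.2 h2, Fin.le_rev_iff.2 h3⟩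
    exact T.isLowerSet hle h

/-- The number of cubes of a plane partition. -/
def size {a b c : ℕ} (T : PlanePartition a b c) : ℕ := T.cubes.card

/-- The linear extension of complementation to a vector space in which the plane partitions
form a basis. -/
noncomputable def complementLinear {a b c : ℕ} {𝕜 V : Type*} [Field 𝕜] [AddCommGroup V]
    [Module 𝕜 V] (B : Module.Basis (PlanePartition a b c) 𝕜 V) : V →ₗ[𝕜] V :=
  B.constr 𝕜 (fun T => B T.complement)

/-- The linear operator, diagonal in the basis of plane partitions, that negates the plane
partitions with an odd number of cubes and fixes those with an even number of cubes. -/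
noncomputable def negateOdd {a b c : ℕ} {𝕜 V : Type*} [Field 𝕜] [AddCommGroup V]
    [Module 𝕜 V] (B : Module.Basis (PlanePartition a b c) 𝕜 V) : V →ₗ[𝕜] V :=
  B.constr 𝕜 (fun T => if Odd T.size then -B T else B T)

end PlanePartition

open Finset

/-! Plane partitions in the box index a basis of a representation of GL_{a+b}, in which both
operators come, up to one common sign, from conjugate matrices.

Let W be the span of all products of c maximal minors of the generic a × (a+b) matrix. The heights
of T encode it as a decreasing chain of c increasing column sequences (`seq`), and the product of
the corresponding minors is its `standardMonomial`. These form a basis of W: Plücker relations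
straighten any product of minors into chains (`prod_selectDet_mem`), and distinct leading terms give
independence (`linearIndependent_standardMonomial`).

Matrices act on W by column operations (`substCols`). Reversing the columns sends the monomial of T
to s times that of κ(T), and negating every other column multiplies it by s(-1)^|T|, where s =
(-1)^(c·a(a-1)/2) both times. Outside characteristic 2 the two matrices are conjugate by some P
(`exists_signMatrix_mul_eq`), and the action of P on W gives g. -/

/-- The determinant of the square matrix whose rows are the vectors `v (I r)`. -/
def selectDet {ι κ K : Type*} [Fintype ι] [DecidableEq ι] [CommRing K] (v : κ → ι → K)
    (I : ι → κ) : K :=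
  Matrix.detRowAlternating fun r => v (I r)

/-! ### Plücker relations between two maximal minors -/

section Exchange

variable {ι κ K : Type*} [Fintype ι] [DecidableEq ι] [CommRing K]

/-- The determinant as an alternating function of the rows satisfying `P`, the other rows being
fixed. -/
def detRowsAlternating (P : ι → Prop) [DecidablePred P] (u : ι → ι → K) :
    (ι → K) [⋀^{r // P r}]→ₗ[K] K where
  __ := (Matrix.detRowAlternating (n := ι) (R := K)).toMultilinearMap.domDomRestrict P
    fun r => u r
  map_eq_zero_of_eq' w i j hw hij := by
    refine Matrix.detRowAlternating.map_eq_zero_of_eq _ (i := i) (j := j) ?_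
      (fun h => hij (Subtype.ext h))
    simp [i.2, j.2, hw]

theorem detRowsAlternating_apply (P : ι → Prop) [DecidablePred P] (u : ι → ι → K)
    (w : {r // P r} → ι → K) :
    detRowsAlternating P u w =
      Matrix.detRowAlternating fun r => if h : P r then w ⟨r, h⟩ else u r := rfl

/-- The entries of `I` at the places satisfying `P`, together with the entries of `J` at the
places satisfying `Q`. -/
def joinEntries (P Q : ι → Prop) (I J : ι → κ) : {r // P r} ⊕ {r // Q r} → κ :=
  Sum.elim (fun r => I r) (fun r => J r)

/-- The first member of the pair obtained from `(I, J)` by permuting the joined entries. -/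
def exchangeLeft (P Q : ι → Prop) [DecidablePred P] (I J : ι → κ)
    (σ : Equiv.Perm ({r // P r} ⊕ {r // Q r})) : ι → κ :=
  fun r => if h : P r then joinEntries P Q I J (σ (Sum.inl ⟨r, h⟩)) else I r

/-- The second member of the pair obtained from `(I, J)` by permuting the joined entries. -/
def exchangeRight (P Q : ι → Prop) [DecidablePred Q] (I J : ι → κ)
    (σ : Equiv.Perm ({r // P r} ⊕ {r // Q r})) : ι → κ :=
  fun r => if h : Q r then joinEntries P Q I J (σ (Sum.inr ⟨r, h⟩)) else J r

/-- The Plücker relation that shuffles more than `card ι` entries of two maximal minors. -/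
theorem selectDet_mul_selectDet_mem [IsDomain K] (v : κ → ι → K) (P Q : ι → Prop)
    [DecidablePred P] [DecidablePred Q] (I J : ι → κ)
    (hcard : Fintype.card ι < Fintype.card {r // P r} + Fintype.card {r // Q r})
    (S : AddSubgroup K) (y : K)
    (hS : ∀ σ : Equiv.Perm ({r // P r} ⊕ {r // Q r}), (∃ r q, σ (Sum.inl r) = Sum.inr q) →
      selectDet v (exchangeLeft P Q I J σ) * selectDet v (exchangeRight P Q I J σ) * y ∈ S) :
    selectDet v I * selectDet v J * y ∈ S := by
  let _ := Classical.decEq (Equiv.Perm.ModSumCongr {r // P r} {r // Q r})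
  set A := detRowsAlternating P fun r => v (I r)
  set B := detRowsAlternating Q fun r => v (J r)
  set w : {r // P r} ⊕ {r // Q r} → ι → K := fun x => v (joinEntries P Q I J x)
  have hterm : ∀ σ : Equiv.Perm ({r // P r} ⊕ {r // Q r}),
      LinearMap.mul' K K (AlternatingMap.domCoprod.summand A B (Quotient.mk'' σ) w) =
        Equiv.Perm.sign σ • (selectDet v (exchangeLeft P Q I J σ) *
          selectDet v (exchangeRight P Q I J σ)) := by
    intro σ
    have hA : A (fun r => w (σ (Sum.inl r))) = selectDet v (exchangeLeft P Q I J σ) := by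
      rw [detRowsAlternating_apply, selectDet]
      congr 1
      funext r
      by_cases h : P r <;> simp [exchangeLeft, h, w]
    have hB : B (fun r => w (σ (Sum.inr r))) = selectDet v (exchangeRight P Q I J σ) := by
      rw [detRowsAlternating_apply, selectDet]
      congr 1
      funext r
      by_cases h : Q r <;> simp [exchangeRight, h, w]
    rw [AlternatingMap.domCoprod.summand_mk'', ← hA, ← hB]
    rcases Int.units_eq_one_or (Equiv.Perm.sign σ) with h | h <;> rw [h] <;> simp
  -- More than `card ι` vectors of `ι → K` are dependent, so the alternating form vanishes on them.
  -- The coset of 1 contributes the product to be rewritten.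
  have hzero : LinearMap.mul' K K (A.domCoprod B w) = 0 := by
    have := ((LinearMap.mul' K K).compAlternatingMap (A.domCoprod B)).map_linearDependent w
      (fun h => by
        have := h.fintype_card_le_finrank
        simp at this
        omega)
    simpa using this
  rw [AlternatingMap.domCoprod_apply, _root_.sum_apply, map_sum] at hzero
  replace hzero := (Fintype.sum_eq_add_sum_compl
    (Quotient.mk'' 1 : Equiv.Perm.ModSumCongr {r // P r} {r // Q r}) fun q =>
      LinearMap.mul' K K (AlternatingMap.domCoprod.summand A B q w)).symm.trans hzero
  rw [hterm] at hzero
  have h1 : exchangeLeft P Q I J 1 = I := by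
    funext r; by_cases h : P r <;> simp [exchangeLeft, joinEntries, h]
  have h2 : exchangeRight P Q I J 1 = J := by
    funext r; by_cases h : Q r <;> simp [exchangeRight, joinEntries, h]
  rw [h1, h2, Equiv.Perm.sign_one, one_smul] at hzero
  rw [eq_neg_of_add_eq_zero_left hzero, neg_mul, Finset.sum_mul]
  refine S.neg_mem (S.sum_mem fun q hq => ?_)
  induction q using Quotient.inductionOn' with | _ σ
  -- A permutation that keeps left places on the left lies in the coset of 1, which has been split
  -- off.
  have hmix : ∃ r q, σ (Sum.inl r) = Sum.inr q := by
    by_contra! hne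
    refine (by simpa using hq : _ ≠ _) (Quotient.sound' ?_)
    rw [QuotientGroup.leftRel_apply]
    refine Subgroup.mul_mem _ (Subgroup.inv_mem _ ?_) (Subgroup.one_mem _)
    apply Equiv.Perm.mem_sumCongrHom_range_of_perm_mapsTo_inl
    rintro _ ⟨r, rfl⟩
    rcases h : σ (Sum.inl r) with r' | q'
    · exact ⟨r', rfl⟩
    · exact absurd h (hne r q')
  rw [hterm, smul_mul_assoc]
  rcases Int.units_eq_one_or (Equiv.Perm.sign σ) with h | h <;> rw [h]
  · simpa using hS σ hmix
  · simpa using hS σ hmix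

omit [DecidableEq ι] in
theorem sum_exchange (w : κ → ℤ) (P Q : ι → Prop) [DecidablePred P] [DecidablePred Q]
    (I J : ι → κ) (σ : Equiv.Perm ({r // P r} ⊕ {r // Q r})) :
    ∑ r, w (exchangeLeft P Q I J σ r) + ∑ r, w (exchangeRight P Q I J σ r) =
      ∑ r, w (I r) + ∑ r, w (J r) := by
  have key : ∀ (P' : ι → Prop) [DecidablePred P'] (F : {r // P' r} → κ) (I : ι → κ),
      ∑ r, w (if h : P' r then F ⟨r, h⟩ else I r) =
        ∑ r : {r // P' r}, w (F r) + ∑ r : {r // ¬ P' r}, w (I r) := by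
    intro P' _ F I
    rw [← Fintype.sum_subtype_add_sum_subtype P']
    congr 1
    · exact Finset.sum_congr rfl fun r _ => by rw [dif_pos r.2]
    · exact Finset.sum_congr rfl fun r _ => by rw [dif_neg r.2]
  have hσ := Equiv.sum_comp σ fun x => w (joinEntries P Q I J x)
  rw [Fintype.sum_sum_type, Fintype.sum_sum_type] at hσ
  simp only [exchangeLeft, exchangeRight]
  rw [key P (fun r => joinEntries P Q I J (σ (Sum.inl r))),
    key Q (fun r => joinEntries P Q I J (σ (Sum.inr r))),
    ← Fintype.sum_subtype_add_sum_subtype P fun r => w (I r),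
    ← Fintype.sum_subtype_add_sum_subtype Q fun r => w (J r)]
  simp only [joinEntries, Sum.elim_inl, Sum.elim_inr] at hσ ⊢
  linarith

-- The left places hold exactly the nonnegative values of `w - m`, so their sum is the largest over
-- any set of places; an exchange brings in a negative value.
omit [DecidableEq ι] in
theorem sum_exchangeLeft_lt (w : κ → ℤ) (P Q : ι → Prop) [DecidablePred P] [DecidablePred Q]
    (I J : ι → κ) (m : ℤ) (hI : ∀ r, P r → m ≤ w (I r)) (hJ : ∀ r, Q r → w (J r) < m)
    (σ : Equiv.Perm ({r // P r} ⊕ {r // Q r})) (hσ : ∃ r q, σ (Sum.inl r) = Sum.inr q) :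
    ∑ r, w (exchangeLeft P Q I J σ r) < ∑ r, w (I r) := by
  have hsub : ∑ r : {r // P r}, (w (joinEntries P Q I J (σ (Sum.inl r))) - m) <
      ∑ r : {r // P r}, (w (I r) - m) := by
    set d : {r // P r} ⊕ {r // Q r} → ℤ := fun x => w (joinEntries P Q I J x) - m
    have hdl : ∀ r, 0 ≤ d (Sum.inl r) := fun r => sub_nonneg.2 (hI _ r.2)
    have hdr : ∀ q, d (Sum.inr q) < 0 := fun q => sub_neg.2 (hJ _ q.2)
    have hmax : ∀ x, d x ≤ max (d x) 0 := fun x => le_max_left _ _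
    calc ∑ r : {r // P r}, d (σ (Sum.inl r))
        < ∑ r : {r // P r}, max (d (σ (Sum.inl r))) 0 := by
          obtain ⟨r, q, h⟩ := hσ
          refine Finset.sum_lt_sum (fun r _ => hmax _) ⟨r, Finset.mem_univ _, ?_⟩
          rw [h]
          exact lt_max_of_lt_right (hdr q)
      _ ≤ ∑ r : {r // P r}, max (d (σ (Sum.inl r))) 0 +
            ∑ q : {q // Q q}, max (d (σ (Sum.inr q))) 0 :=
          le_add_of_nonneg_right (Finset.sum_nonneg fun _ _ => le_max_right _ _)
      _ = ∑ x, max (d x) 0 := by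
          rw [← Fintype.sum_sum_type fun x => max (d (σ x)) 0]
          exact Equiv.sum_comp σ fun x => max (d x) 0
      _ = ∑ r : {r // P r}, d (Sum.inl r) := by
          rw [Fintype.sum_sum_type]
          simp only [max_eq_left (hdl _), max_eq_right (hdr _).le]
          simp
  rw [Finset.sum_sub_distrib, Finset.sum_sub_distrib] at hsub
  rw [← Fintype.sum_subtype_add_sum_subtype P, ← Fintype.sum_subtype_add_sum_subtype P
    fun r => w (I r)]
  have h1 : ∑ r : {r // P r}, w (exchangeLeft P Q I J σ r) =
      ∑ r : {r // P r}, w (joinEntries P Q I J (σ (Sum.inl r))) :=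
    Finset.sum_congr rfl fun r _ => by simp [exchangeLeft, r.2]
  have h2 : ∑ r : {r // ¬ P r}, w (exchangeLeft P Q I J σ r) =
      ∑ r : {r // ¬ P r}, w (I r) :=
    Finset.sum_congr rfl fun r _ => by simp [exchangeLeft, r.2]
  linarith

end Exchange

/-! ### Straightening of products of minors -/

section Straightening

theorem selectDet_comp_perm {ι κ K : Type*} [Fintype ι] [DecidableEq ι] [CommRing K]
    (v : κ → ι → K) (I : ι → κ) (σ : Equiv.Perm ι) :
    selectDet v (I ∘ σ) = Equiv.Perm.sign σ • selectDet v I :=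
  Matrix.detRowAlternating.map_perm (fun r => v (I r)) σ

theorem selectDet_eq_zero_of_not_injective {ι κ K : Type*} [Fintype ι] [DecidableEq ι]
    [CommRing K] (v : κ → ι → K) {I : ι → κ} (hI : ¬ Function.Injective I) :
    selectDet v I = 0 := by
  obtain ⟨i, j, h, hij⟩ := Function.not_injective_iff.1 hI
  exact Matrix.detRowAlternating.map_eq_zero_of_eq _ (congrArg v h) hij

/-- Serves twice in the straightening: for minors, and in `Multiplicative ℤ` for sums of squared
contents. -/
theorem prod_update_update {α β M : Type*} [Fintype α] [DecidableEq α] [CommMonoid M]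
    (F : β → M) (f : α → β) {k l : α} (hkl : k ≠ l) (x y : β) :
    ∏ t, F (Function.update (Function.update f k x) l y t) =
      F x * F y * ∏ t ∈ (univ.erase k).erase l, F (f t) := by
  rw [← Finset.mul_prod_erase univ _ (mem_univ k),
    ← Finset.mul_prod_erase (univ.erase k) _ (mem_erase.2 ⟨hkl.symm, mem_univ l⟩), ← mul_assoc]
  congr 1
  · simp [Function.update_of_ne hkl]
  · refine Finset.prod_congr rfl fun t ht => ?_
    simp only [mem_erase] at ht
    rw [Function.update_of_ne ht.1, Function.update_of_ne ht.2.1]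

/-- The sum of the entries of a sequence of column indices. -/
def content {a N : ℕ} (I : Fin a → Fin N) : ℤ := ∑ r, ((I r : ℕ) : ℤ)

variable {a N c : ℕ} {K : Type*} [CommRing K]

theorem content_nonneg (I : Fin a → Fin N) : 0 ≤ content I :=
  Finset.sum_nonneg fun _ _ => by positivity

theorem content_le (I : Fin a → Fin N) : content I ≤ a * N := by
  refine (Finset.sum_le_card_nsmul univ _ (N : ℤ) fun r _ => ?_).trans (by simp)
  exact_mod_cast (I r).2.le

theorem content_comp_perm (I : Fin a → Fin N) (σ : Equiv.Perm (Fin a)) :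
    content (I ∘ σ) = content I :=
  Equiv.sum_comp σ fun r => ((I r : ℕ) : ℤ)

theorem le_of_comparable_of_content_le {I J : Fin a → Fin N} (h : I ≤ J ∨ J ≤ I)
    (hc : content I ≤ content J) : I ≤ J := by
  rcases h with h | h
  · exact h
  · have hle : ∀ r ∈ univ, ((J r : ℕ) : ℤ) ≤ ((I r : ℕ) : ℤ) := fun r _ => by
      exact_mod_cast h r
    have heq := (Finset.sum_eq_sum_iff_of_le hle).1
      (le_antisymm (Finset.sum_le_sum hle) hc)
    intro r
    have := heq r (mem_univ r)
    have h2 : (J r : ℕ) = I r := by exact_mod_cast this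
    exact (Fin.ext h2).ge

/-- A chain of sequences can be listed in decreasing order. -/
theorem exists_perm_antitone (f : Fin c → Fin a → Fin N)
    (hf : ∀ k l, f k ≤ f l ∨ f l ≤ f k) : ∃ τ : Equiv.Perm (Fin c), Antitone (f ∘ τ) := by
  refine ⟨Tuple.sort fun k => OrderDual.toDual (content (f k)), fun k l hkl => ?_⟩
  exact le_of_comparable_of_content_le (hf _ _)
    (Tuple.monotone_sort (fun k => OrderDual.toDual (content (f k))) hkl)

/-- One straightening step: the product of two incomparable minors is a combination of products
whose contents are further apart. -/
theorem selectDet_mul_selectDet_mem_of_not_le [IsDomain K] (v : Fin N → Fin a → K)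
    {I J : Fin a → Fin N} (hI : StrictMono I) (hJ : StrictMono J) (hIJ : ¬ I ≤ J)
    (hc : content I ≤ content J) (S : AddSubgroup K) (y : K)
    (hS : ∀ I' J' : Fin a → Fin N,
      content I ^ 2 + content J ^ 2 < content I' ^ 2 + content J' ^ 2 →
        selectDet v I' * selectDet v J' * y ∈ S) :
    selectDet v I * selectDet v J * y ∈ S := by
  obtain ⟨p, hp⟩ : ∃ p, J p < I p := by
    simpa [Pi.le_def] using hIJ
  -- The entries of `I` from `p` on and those of `J` up to `p` number `a + 1`, and as `J p < I p`,
  -- each of the former exceeds each of the latter.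
  refine selectDet_mul_selectDet_mem v (fun r => p ≤ r) (fun r => r ≤ p) I J ?_ S y
    fun σ hσ => hS _ _ ?_
  · simp only [Fintype.card_subtype, filter_le_eq_Ici, filter_ge_eq_Iic, Fin.card_Ici,
      Fin.card_Iic, Fintype.card_fin]
    omega
  · have h1 := sum_exchange (fun x : Fin N => ((x : ℕ) : ℤ)) (fun r => p ≤ r) (fun r => r ≤ p)
      I J σ
    have h2 := sum_exchangeLeft_lt (fun x : Fin N => ((x : ℕ) : ℤ)) (fun r => p ≤ r)
      (fun r => r ≤ p) I J ((I p : ℕ) : ℤ) (fun r hr => by exact_mod_cast hI.monotone hr)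
      (fun r hr => by exact_mod_cast (hJ.monotone hr).trans_lt hp) σ hσ
    change content _ + content _ = content I + content J at h1
    change content _ < content I at h2
    -- Moving t > 0 from `content I` to `content J` raises the sum of squares by 2t(content J -
    -- content I) + 2t².
    rw [eq_sub_of_add_eq' h1]
    nlinarith [mul_nonneg (sub_nonneg.2 h2.le) (sub_nonneg.2 hc), mul_pos (sub_pos.2 h2)
      (sub_pos.2 h2)]

/-- Straightening: every product of `c` maximal minors is a combination of products of chains of
`c` maximal minors. -/
theorem prod_selectDet_mem [IsDomain K] (v : Fin N → Fin a → K) (S : AddSubgroup K)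
    (hS : ∀ f : Fin c → Fin a → Fin N, (∀ k, StrictMono (f k)) → Antitone f →
      ∏ k, selectDet v (f k) ∈ S) (f : Fin c → Fin a → Fin N) :
    ∏ k, selectDet v (f k) ∈ S := by
  have hbound : ∀ f : Fin c → Fin a → Fin N,
      ∑ k, content (f k) ^ 2 ≤ c * ((a : ℤ) * N) ^ 2 := by
    intro f
    refine (Finset.sum_le_card_nsmul univ _ (((a : ℤ) * N) ^ 2) fun k _ => ?_).trans (by simp)
    exact pow_le_pow_left₀ (content_nonneg _) (content_le _) 2
  -- The sum of squared contents is bounded and grows with each straightening step; its distance to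
  -- the bound is the induction measure.
  induction h : (c * ((a : ℤ) * N) ^ 2 - ∑ k, content (f k) ^ 2).toNat
    using Nat.strong_induction_on generalizing f with | _ n ih
  by_cases hinj : ∀ k, Function.Injective (f k)
  swap
  · push Not at hinj
    obtain ⟨k, hk⟩ := hinj
    rw [Finset.prod_eq_zero (mem_univ k) (selectDet_eq_zero_of_not_injective v hk)]
    exact S.zero_mem
  set g : Fin c → Fin a → Fin N := fun k => f k ∘ Tuple.sort (f k) with hg
  have hgf : ∑ k, content (g k) ^ 2 = ∑ k, content (f k) ^ 2 := by
    simp only [hg, content_comp_perm]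
  have hgmono : ∀ k, StrictMono (g k) := fun k =>
    (Tuple.monotone_sort (f k)).strictMono_of_injective
      ((hinj k).comp (Tuple.sort (f k)).injective)
  suffices hgS : ∏ k, selectDet v (g k) ∈ S by
    have : ∏ k, selectDet v (g k) =
        (∏ k, Equiv.Perm.sign (Tuple.sort (f k))) • ∏ k, selectDet v (f k) := by
      simp only [hg, selectDet_comp_perm, Finset.prod_smul]
    rw [this] at hgS
    rcases Int.units_eq_one_or (∏ k, Equiv.Perm.sign (Tuple.sort (f k))) with h1 | h1 <;>
      rw [h1] at hgS <;> simpa using hgS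
  by_cases hchain : ∀ k l, g k ≤ g l ∨ g l ≤ g k
  · obtain ⟨τ, hτ⟩ := exists_perm_antitone g hchain
    rw [← Equiv.prod_comp τ]
    exact hS (g ∘ τ) (fun k => hgmono _) hτ
  · obtain ⟨k, l, hkl, hc⟩ : ∃ k l, ¬ g k ≤ g l ∧ content (g k) ≤ content (g l) := by
      push Not at hchain
      obtain ⟨k, l, h1, h2⟩ := hchain
      rcases le_total (content (g k)) (content (g l)) with h3 | h3
      · exact ⟨k, l, h1, h3⟩
      · exact ⟨l, k, h2, h3⟩
    have hne : k ≠ l := fun h => hkl (h ▸ le_rfl)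
    have hsplit := prod_update_update (selectDet v) g hne (g k) (g l)
    rw [Function.update_eq_self, Function.update_eq_self] at hsplit
    rw [hsplit]
    refine selectDet_mul_selectDet_mem_of_not_le v (hgmono k) (hgmono l) hkl hc S _
      fun I' J' hlt => ?_
    rw [← prod_update_update (selectDet v) g hne I' J']
    refine ih _ ?_ _ rfl
    have e1 := prod_update_update (M := Multiplicative ℤ)
      (fun I => Multiplicative.ofAdd (content I ^ 2)) g hne I' J'
    have e2 := prod_update_update (M := Multiplicative ℤ)
      (fun I => Multiplicative.ofAdd (content I ^ 2)) g hne (g k) (g l)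
    rw [Function.update_eq_self, Function.update_eq_self] at e2
    simp only [← ofAdd_sum, ← ofAdd_add] at e1 e2
    replace e1 := Multiplicative.ofAdd.injective e1
    replace e2 := Multiplicative.ofAdd.injective e2
    have := hbound (Function.update (Function.update g k I') l J')
    omega

end Straightening

/-! ### Plane partitions as chains of strictly increasing sequences -/

theorem Fin.mem_iff_lt_card_of_isLowerSet {n : ℕ} {s : Finset (Fin n)}
    (hs : IsLowerSet (s : Set (Fin n))) (i : Fin n) : i ∈ s ↔ (i : ℕ) < #s := by
  constructor
  · intro hi
    have : #(Iic i) ≤ #s := card_le_card fun j hj => hs (mem_Iic.1 hj) hi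
    rw [Fin.card_Iic] at this
    omega
  · intro hi
    by_contra hn
    have : #s ≤ #(Iio i) := card_le_card fun j hj => mem_Iio.2 <| by
      by_contra hij
      exact hn (hs (not_lt.1 hij) hj)
    rw [Fin.card_Iio] at this
    omega

theorem Fin.le_val_of_strictMono {a N : ℕ} {I : Fin a → Fin N} (hI : StrictMono I) (r : Fin a) :
    (r : ℕ) ≤ I r := by
  obtain ⟨r, hr⟩ := r
  induction r with
  | zero => exact Nat.zero_le _
  | succ r ih =>
    have h1 := ih (by omega)
    have h2 : I ⟨r, by omega⟩ < I ⟨r + 1, hr⟩ := hI (by simp [Fin.lt_def])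
    simp only [Fin.lt_def] at h1 h2 ⊢
    omega

theorem Fin.val_add_le_of_strictMono {a N : ℕ} {I : Fin a → Fin N} (hI : StrictMono I)
    {r s : Fin a} (h : r ≤ s) : (I r : ℕ) + s ≤ I s + r := by
  obtain ⟨s, hs⟩ := s
  induction s with
  | zero =>
    obtain rfl : r = ⟨0, hs⟩ := Fin.ext (Nat.le_zero.1 h)
    exact le_rfl
  | succ s ih =>
    rcases h.lt_or_eq with h | rfl
    · have h1 := ih (by omega) (Nat.lt_succ_iff.1 h)
      have h2 : I ⟨s, by omega⟩ < I ⟨s + 1, hs⟩ := hI (by simp [Fin.lt_def])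
      simp only [Fin.lt_def] at h1 h2 ⊢
      omega
    · exact le_rfl

theorem Fin.val_le_add_of_strictMono {a b : ℕ} {I : Fin a → Fin (a + b)} (hI : StrictMono I)
    (r : Fin a) : (I r : ℕ) ≤ r + b := by
  have ha := r.pos
  have h := Fin.val_add_le_of_strictMono hI (s := ⟨a - 1, by omega⟩)
    (show r ≤ ⟨a - 1, by omega⟩ from Nat.le_sub_one_of_lt r.2)
  have h2 := (I ⟨a - 1, by omega⟩).2
  simp only at h
  omega

namespace PlanePartition

variable {a b c : ℕ}

/-- The number of cubes in the row of `T` at the given first and third coordinates. -/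
def height (T : PlanePartition a b c) (i : Fin a) (k : Fin c) : ℕ :=
  #{j : Fin b | (i, j, k) ∈ T.cubes}

theorem mem_cubes_iff_lt_height (T : PlanePartition a b c) (i : Fin a) (j : Fin b) (k : Fin c) :
    (i, j, k) ∈ T.cubes ↔ (j : ℕ) < T.height i k := by
  rw [height, ← Fin.mem_iff_lt_card_of_isLowerSet]
  · simp
  · intro x y hyx hx
    simp only [coe_filter, mem_univ, true_and, Set.mem_ofPred_eq] at hx ⊢
    exact T.isLowerSet (Prod.mk_le_mk.2 ⟨le_rfl, Prod.mk_le_mk.2 ⟨hyx, le_rfl⟩⟩) hx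

theorem mem_cubes_iff_lt_card (T : PlanePartition a b c) (i : Fin a) (j : Fin b) (k : Fin c) :
    (i, j, k) ∈ T.cubes ↔ (k : ℕ) < #{k : Fin c | (i, j, k) ∈ T.cubes} := by
  rw [← Fin.mem_iff_lt_card_of_isLowerSet]
  · simp
  · intro x y hyx hx
    simp only [coe_filter, mem_univ, true_and, Set.mem_ofPred_eq] at hx ⊢
    exact T.isLowerSet (Prod.mk_le_mk.2 ⟨le_rfl, Prod.mk_le_mk.2 ⟨le_rfl, hyx⟩⟩) hx

theorem height_le (T : PlanePartition a b c) (i : Fin a) (k : Fin c) : T.height i k ≤ b :=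
  (card_le_univ _).trans (Fintype.card_fin b).le

theorem height_anti (T : PlanePartition a b c) {i i' : Fin a} {k k' : Fin c} (hi : i' ≤ i)
    (hk : k' ≤ k) : T.height i k ≤ T.height i' k' := by
  refine card_le_card fun j hj => ?_
  simp only [mem_filter, mem_univ, true_and] at hj ⊢
  exact T.isLowerSet (Prod.mk_le_mk.2 ⟨hi, Prod.mk_le_mk.2 ⟨le_rfl, hk⟩⟩) hj

theorem size_eq_sum_height (T : PlanePartition a b c) :
    T.size = ∑ k, ∑ i, T.height i k := by
  simp only [size, height, card_filter]
  rw [← Finset.sum_comm, ← Finset.filter_univ_mem T.cubes, card_filter, Fintype.sum_prod_type]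
  refine Finset.sum_congr rfl fun i _ => ?_
  rw [Fintype.sum_prod_type_right]
  simp

theorem mem_cubes_complement (T : PlanePartition a b c) (x : Fin a × Fin b × Fin c) :
    x ∈ T.complement.cubes ↔ revCube x ∉ T.cubes := by
  simp only [complement, mem_image, mem_compl]
  constructor
  · rintro ⟨y, hy, rfl⟩
    simpa [revCube] using hy
  · exact fun h => ⟨_, h, by simp [revCube]⟩

theorem height_complement (T : PlanePartition a b c) (i : Fin a) (k : Fin c) :
    T.complement.height i k + T.height i.rev k.rev = b := by
  have h1 : T.height i.rev k.rev = #{j : Fin b | ¬ (i, j, k) ∈ T.complement.cubes} := by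
    rw [height, ← card_map Fin.revPerm.toEmbedding]
    congr 1
    ext j
    simp only [mem_map_equiv, mem_filter, mem_univ, true_and, mem_cubes_complement, not_not]
    simp [revCube]
  rw [h1, height, card_filter_add_card_filter_not]
  simp

/-- The plane partition as a chain of strictly increasing sequences. -/
def seq (T : PlanePartition a b c) (k : Fin c) (r : Fin a) : Fin (a + b) :=
  -- Heights decrease in the first coordinate, hence `r.rev`; adding `r` makes the increase strict.
  ⟨r + T.height r.rev k, by have := T.height_le r.rev k; omega⟩

theorem seq_strictMono (T : PlanePartition a b c) (k : Fin c) : StrictMono (T.seq k) := by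
  intro r s hrs
  have := T.height_anti (Fin.rev_le_rev.2 hrs.le) (le_refl k)
  simp only [seq, Fin.lt_def] at hrs ⊢
  omega

/-- The plane partition corresponding to a decreasing chain of strictly increasing sequences. -/
def ofChain (f : Fin c → Fin a → Fin (a + b)) (hf : ∀ k, StrictMono (f k)) (hf' : Antitone f) :
    PlanePartition a b c where
  cubes := {x | (x.2.1 : ℕ) + x.1.rev < f x.2.2 x.1.rev}
  isLowerSet := by
    rintro ⟨i, j, k⟩ ⟨i', j', k'⟩ ⟨hi, hj, hk⟩ hx
    simp only [coe_filter, mem_univ, true_and, Set.mem_ofPred_eq] at hi hj hk hx ⊢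
    have h1 := Fin.val_add_le_of_strictMono (hf k) (Fin.rev_le_rev.2 hi)
    have h2 : (f k i'.rev : ℕ) ≤ f k' i'.rev := hf' hk i'.rev
    have h3 : (j' : ℕ) ≤ j := hj
    omega

theorem seq_ofChain (f : Fin c → Fin a → Fin (a + b)) (hf : ∀ k, StrictMono (f k))
    (hf' : Antitone f) : (ofChain f hf hf').seq = f := by
  funext k r
  apply Fin.ext
  have h1 := Fin.le_val_of_strictMono (hf k) r
  have h2 := Fin.val_le_add_of_strictMono (hf k) r
  have h3 : (ofChain f hf hf').height r.rev k = f k r - r := by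
    have : ∀ j : Fin b, (r.rev, j, k) ∈ (ofChain f hf hf').cubes ↔ (j : ℕ) < f k r - r := by
      intro j
      simp only [ofChain, mem_filter, mem_univ, true_and, Fin.rev_rev]
      omega
    simp only [height, this, Fin.card_filter_val_lt]
    omega
  simp only [seq, h3]
  omega

/-- Opposite heights h and b - h are complementary, and r + (b - h) is the reverse in `Fin (a + b)`
of (a - 1 - r) + h. -/
theorem seq_complement (T : PlanePartition a b c) (k : Fin c) :
    T.complement.seq k = Fin.rev ∘ T.seq k.rev ∘ Fin.rev := by
  funext r
  apply Fin.ext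
  have := T.height_complement r.rev k
  rw [Fin.rev_rev] at this
  simp only [seq, Function.comp_apply, Fin.rev_rev, Fin.val_rev]
  omega

end PlanePartition

/-! ### Linear independence of the standard monomials -/

/-- A family is linearly independent if it is triangular for a family of linear forms. -/
theorem linearIndependent_of_triangular {ι 𝕜 M : Type*} [CommRing 𝕜] [AddCommGroup M]
    [Module 𝕜 M] (v : ι → M) (φ : ι → M →ₗ[𝕜] 𝕜) (w : ι → ℕ)
    (h1 : ∀ i, φ i (v i) = 1) (h2 : ∀ i j, i ≠ j → φ i (v j) ≠ 0 → w i < w j) :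
    LinearIndependent 𝕜 v := by
  classical
  rw [linearIndependent_iff']
  intro s g hg
  by_contra! hne
  obtain ⟨i₀, hi₀, hgi₀⟩ := hne
  -- The form attached to an index of maximal weight in the support kills all other terms of the
  -- relation.
  obtain ⟨i, hi, hmax⟩ := Finset.exists_max_image {i ∈ s | g i ≠ 0} w ⟨i₀, by simp [hi₀, hgi₀]⟩
  rw [mem_filter] at hi
  have hφ := congrArg (φ i) hg
  rw [map_sum, map_zero, Finset.sum_eq_single_of_mem i hi.1, map_smul, h1, smul_eq_mul,
    mul_one] at hφ
  · exact hi.2 hφ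
  · intro j hj hji
    rw [map_smul, smul_eq_mul]
    by_contra hne
    have hlt := h2 i j hji.symm (right_ne_zero_of_mul hne)
    exact absurd (hmax j (mem_filter.2 ⟨hj, left_ne_zero_of_mul hne⟩)) (not_le.2 hlt)

section Independence

variable {a N c : ℕ} {𝕜 : Type*} [CommRing 𝕜]

/-- The columns of the generic `a × N` matrix. -/
noncomputable def genericCol (𝕜 : Type*) [CommRing 𝕜] {a N : ℕ} (j : Fin N) (r : Fin a) :
    MvPolynomial (Fin a × Fin N) 𝕜 :=
  MvPolynomial.X (r, j)

/-- The exponent of a term in the expansion of a product of `c` minors of the generic matrix. -/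
noncomputable def exponent (f : Fin c → Fin a → Fin N) (σ : Fin c → Equiv.Perm (Fin a)) :
    Fin a × Fin N →₀ ℕ :=
  ∑ k, ∑ r, Finsupp.single (r, f k (σ k r)) 1

theorem linearCombination_exponent (w : Fin a × Fin N → ℕ) (f : Fin c → Fin a → Fin N)
    (σ : Fin c → Equiv.Perm (Fin a)) :
    Finsupp.linearCombination ℕ w (exponent f σ) = ∑ k, ∑ r, w (r, f k (σ k r)) := by
  simp [exponent, map_sum, Finsupp.linearCombination_single]

theorem prod_selectDet_genericCol (f : Fin c → Fin a → Fin N) :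
    ∏ k, selectDet (genericCol 𝕜) (f k) =
      ∑ σ : Fin c → Equiv.Perm (Fin a), (∏ k, Equiv.Perm.sign (σ k)) •
        MvPolynomial.monomial (exponent f σ) (1 : 𝕜) := by
  have h : ∀ k, selectDet (genericCol 𝕜) (f k) = ∑ σ : Equiv.Perm (Fin a),
      Equiv.Perm.sign σ • ∏ r, MvPolynomial.X (R := 𝕜) (r, f k (σ r)) :=
    fun k => Matrix.det_apply _
  simp only [h]
  rw [Finset.prod_univ_sum, Fintype.piFinset_univ]
  refine Finset.sum_congr rfl fun σ _ => ?_
  rw [Finset.prod_smul]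
  congr 1
  simp only [exponent, MvPolynomial.X, MvPolynomial.monomial_sum_one]

/-- The weight of an exponent for which the diagonal terms of minors are the heaviest ones. -/
noncomputable def weight (f : Fin c → Fin a → Fin N) (σ : Fin c → Equiv.Perm (Fin a)) : ℕ :=
  Finsupp.linearCombination ℕ (fun x : Fin a × Fin N => (x.1 : ℕ) * (x.2 : ℕ)) (exponent f σ)

/-- Rearrangement inequality; equality would make every `σ k` monotone, hence the identity. -/
theorem weight_lt {f : Fin c → Fin a → Fin N} (hf : ∀ k, StrictMono (f k))
    {σ : Fin c → Equiv.Perm (Fin a)} (hσ : σ ≠ 1) : weight f σ < weight f 1 := by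
  simp only [weight, linearCombination_exponent, Pi.one_apply, Equiv.Perm.one_apply]
  have hmono : ∀ k, Monovary (fun r : Fin a => (r : ℕ)) fun r => (f k r : ℕ) := fun k =>
    Monotone.monovary Fin.val_strictMono.monotone
      (Fin.val_strictMono.comp (hf k)).monotone
  have hle : ∀ k, ∑ r : Fin a, (r : ℕ) * (f k (σ k r) : ℕ) ≤
      ∑ r : Fin a, (r : ℕ) * (f k r : ℕ) := fun k =>
    (hmono k).sum_mul_comp_perm_le_sum_mul (σ := σ k)
  obtain ⟨k, hk⟩ := Function.ne_iff.1 hσ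
  refine Finset.sum_lt_sum (fun k _ => hle k) ⟨k, mem_univ k, (hle k).lt_of_ne fun heq => hk ?_⟩
  have h := ((hmono k).sum_mul_comp_perm_eq_sum_mul_iff (σ := σ k)).1 heq
  have hσk : Monotone (σ k) := fun r s hrs => by
    by_contra hlt
    have h1 : r < s := lt_of_le_of_ne hrs fun h => hlt (h ▸ le_rfl)
    have h2 : (s : ℕ) ≤ r := h (Fin.val_strictMono (hf k (not_le.1 hlt)))
    exact absurd h1 (not_lt.2 h2)
  have := Subsingleton.elim
    ((hσk.strictMono_of_injective (σ k).injective).orderIsoOfSurjective _ (σ k).surjective)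
    (OrderIso.refl _)
  ext r
  exact congrArg Fin.val (DFunLike.congr_fun this r)

end Independence

namespace PlanePartition

variable {a b c : ℕ}

/-- The standard monomial of a plane partition. -/
noncomputable def standardMonomial (𝕜 : Type*) [CommRing 𝕜] (T : PlanePartition a b c) :
    MvPolynomial (Fin a × Fin (a + b)) 𝕜 :=
  ∏ k, selectDet (genericCol 𝕜) (T.seq k)

/-- Diagonal variables in row `i.rev` with column beyond `j + i.rev` count the `k` with `(i, j, k)`
in `T`. These counts determine `T`, which is downward closed in `k`. -/
theorem exponent_seq_injective {T T' : PlanePartition a b c}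
    (h : exponent T.seq 1 = exponent T'.seq 1) : T = T' := by
  have key : ∀ (T : PlanePartition a b c) (i : Fin a) (j : Fin b),
      #{k : Fin c | (i, j, k) ∈ T.cubes} = Finsupp.linearCombination ℕ
        (fun x : Fin a × Fin (a + b) => if x.1 = i.rev ∧ (j : ℕ) + i.rev < x.2 then 1 else 0)
        (exponent T.seq 1) := by
    intro T i j
    rw [linearCombination_exponent, card_filter]
    refine Finset.sum_congr rfl fun k _ => ?_
    rw [Finset.sum_eq_single i.rev]
    · congr 1
      simp only [Pi.one_apply, Equiv.Perm.one_apply, seq, mem_cubes_iff_lt_height, Fin.rev_rev,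
        true_and, eq_iff_iff]
      omega
    · intro r _ hr
      simp [hr]
    · simp
  ext ⟨i, j, k⟩
  rw [mem_cubes_iff_lt_card, mem_cubes_iff_lt_card, key, key, h]

/-- The diagonal exponent of `T` has coefficient 1 in its own monomial. In another monomial it can
only be an off-diagonal exponent, so that monomial has a heavier diagonal. -/
theorem linearIndependent_standardMonomial (𝕜 : Type*) [CommRing 𝕜] :
    LinearIndependent 𝕜 (standardMonomial 𝕜 : PlanePartition a b c → _) := by
  classical
  have hcoeff : ∀ (d : Fin a × Fin (a + b) →₀ ℕ) (T : PlanePartition a b c),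
      MvPolynomial.lcoeff 𝕜 d (standardMonomial 𝕜 T) =
        ∑ σ : Fin c → Equiv.Perm (Fin a), (∏ k, Equiv.Perm.sign (σ k)) •
          if exponent T.seq σ = d then (1 : 𝕜) else 0 := by
    intro d T
    rw [standardMonomial, prod_selectDet_genericCol, map_sum]
    refine Finset.sum_congr rfl fun σ _ => ?_
    rw [Units.smul_def, Units.smul_def, map_zsmul]
    simp [MvPolynomial.coeff_monomial]
  refine linearIndependent_of_triangular _
    (fun T => MvPolynomial.lcoeff 𝕜 (exponent T.seq 1)) (fun T => weight T.seq 1) ?_ ?_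
  · intro T
    rw [hcoeff, Finset.sum_eq_single 1]
    · simp
    · intro σ _ hσ
      rw [if_neg, smul_zero]
      exact fun h => (weight_lt T.seq_strictMono hσ).ne (by rw [weight, weight, h])
    · simp
  · intro T T' hne h
    rw [hcoeff] at h
    obtain ⟨σ, -, hσ⟩ := Finset.exists_ne_zero_of_sum_ne_zero h
    have heq : exponent T'.seq σ = exponent T.seq 1 := by
      by_contra h'
      simp [h'] at hσ
    have hσ1 : σ ≠ 1 := by
      rintro rfl
      exact hne (exponent_seq_injective heq).symm
    calc weight T.seq 1 = weight T'.seq σ := by rw [weight, weight, heq]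
      _ < weight T'.seq 1 := weight_lt T'.seq_strictMono hσ1

end PlanePartition

/-! ### Column operations and the invariant span -/

section ColumnSubstitution

variable {a N c : ℕ} {𝕜 : Type*} [CommRing 𝕜]

theorem detRowAlternating_smul_univ {ι K A : Type*} [Fintype ι] [DecidableEq ι]
    [CommRing K] [CommRing A] [Algebra A K] (d : ι → A) (u : ι → ι → K) :
    Matrix.detRowAlternating (fun r => d r • u r) =
      (∏ r, d r) • Matrix.detRowAlternating u := by
  have h := (Matrix.detRowAlternating (n := ι) (R := K)).toMultilinearMap.map_smul_univ
    (fun r => algebraMap A K (d r)) u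
  simp only [← map_prod, algebraMap_smul] at h
  exact h

theorem selectDet_sum_smul {ι κ K A : Type*} [Fintype ι] [DecidableEq ι] [Fintype κ]
    [CommRing K] [CommRing A] [Algebra A K] (v : κ → ι → K) (M : Matrix κ κ A) (I : ι → κ) :
    selectDet (fun j => ∑ l, M l j • v l) I =
      ∑ J : ι → κ, (∏ r, M (J r) (I r)) • selectDet v J := by
  classical
  have h := (Matrix.detRowAlternating (n := ι) (R := K)).toMultilinearMap.map_sum
    fun r l => M l (I r) • v l
  exact h.trans (Finset.sum_congr rfl fun J _ => detRowAlternating_smul_univ _ _)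

theorem selectDet_smul {ι κ K A : Type*} [Fintype ι] [DecidableEq ι]
    [CommRing K] [CommRing A] [Algebra A K] (v : κ → ι → K) (d : κ → A) (I : ι → κ) :
    selectDet (fun j => d j • v j) I = (∏ r, d (I r)) • selectDet v I :=
  detRowAlternating_smul_univ _ _

/-- The algebra endomorphism that multiplies the generic matrix by `M` on the right. -/
noncomputable def substCols (M : Matrix (Fin N) (Fin N) 𝕜) :
    MvPolynomial (Fin a × Fin N) 𝕜 →ₐ[𝕜] MvPolynomial (Fin a × Fin N) 𝕜 :=
  MvPolynomial.aeval fun x => ∑ l, M l x.2 • genericCol 𝕜 l x.1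

theorem substCols_genericCol (M : Matrix (Fin N) (Fin N) 𝕜) (j : Fin N) (r : Fin a) :
    substCols M (genericCol 𝕜 j r) = ∑ l, M l j • genericCol 𝕜 l r :=
  MvPolynomial.aeval_X _ _

theorem substCols_substCols (A B : Matrix (Fin N) (Fin N) 𝕜)
    (p : MvPolynomial (Fin a × Fin N) 𝕜) :
    substCols A (substCols B p) = substCols (A * B) p := by
  suffices h : (substCols A).comp (substCols B) = substCols (a := a) (A * B) from
    DFunLike.congr_fun h p
  refine MvPolynomial.algHom_ext fun x => ?_
  change substCols A (substCols B (genericCol 𝕜 x.2 x.1)) =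
    substCols (A * B) (genericCol 𝕜 x.2 x.1)
  simp only [substCols_genericCol, map_sum, map_smul, Matrix.mul_apply, Finset.smul_sum,
    Finset.sum_smul, smul_smul]
  rw [Finset.sum_comm]
  simp only [mul_comm]

theorem substCols_one (p : MvPolynomial (Fin a × Fin N) 𝕜) :
    substCols (1 : Matrix (Fin N) (Fin N) 𝕜) p = p := by
  suffices h : substCols 1 = AlgHom.id 𝕜 (MvPolynomial (Fin a × Fin N) 𝕜) from
    DFunLike.congr_fun h p
  refine MvPolynomial.algHom_ext fun x => ?_
  change substCols 1 (genericCol 𝕜 x.2 x.1) = genericCol 𝕜 x.2 x.1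
  simp [substCols_genericCol, Matrix.one_apply]

theorem substCols_selectDet (M : Matrix (Fin N) (Fin N) 𝕜) (I : Fin a → Fin N) :
    substCols M (selectDet (genericCol 𝕜) I) =
      selectDet (fun j => ∑ l, M l j • genericCol 𝕜 l) I := by
  refine ((substCols M).map_det _).trans (congrArg Matrix.det ?_)
  refine Matrix.ext fun r s => ?_
  change substCols M (genericCol 𝕜 (I r) s) =
    (∑ l, M l (I r) • genericCol 𝕜 l : Fin a → MvPolynomial (Fin a × Fin N) 𝕜) s
  simp [substCols_genericCol]

end ColumnSubstitution

namespace PlanePartition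

variable {a b c : ℕ} {𝕜 : Type*} [CommRing 𝕜]

theorem prod_selectDet_mem_span [IsDomain 𝕜] (f : Fin c → Fin a → Fin (a + b)) :
    ∏ k, selectDet (genericCol 𝕜) (f k) ∈
      Submodule.span 𝕜 (Set.range (standardMonomial 𝕜 : PlanePartition a b c → _)) := by
  refine prod_selectDet_mem (genericCol 𝕜) (Submodule.toAddSubgroup (Submodule.span 𝕜
    (Set.range (standardMonomial 𝕜 : PlanePartition a b c → _)))) (fun f hf hf' => ?_) f
  refine Submodule.subset_span ⟨ofChain f hf hf', ?_⟩
  rw [standardMonomial, seq_ofChain]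

/-- By multilinearity a column operation turns a product of minors into a combination of products of
minors on arbitrary sequences, which straightening returns to the span. -/
theorem substCols_mem_span [IsDomain 𝕜] (M : Matrix (Fin (a + b)) (Fin (a + b)) 𝕜)
    {p : MvPolynomial (Fin a × Fin (a + b)) 𝕜}
    (hp : p ∈ Submodule.span 𝕜 (Set.range (standardMonomial 𝕜 : PlanePartition a b c → _))) :
    substCols M p ∈
      Submodule.span 𝕜 (Set.range (standardMonomial 𝕜 : PlanePartition a b c → _)) := by
  suffices h : Submodule.span 𝕜 (Set.range (standardMonomial 𝕜 : PlanePartition a b c → _)) ≤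
      Submodule.comap (substCols M).toLinearMap
        (Submodule.span 𝕜 (Set.range (standardMonomial 𝕜 : PlanePartition a b c → _))) from h hp
  rw [Submodule.span_le]
  rintro _ ⟨T, rfl⟩
  change substCols M (standardMonomial 𝕜 T) ∈
    Submodule.span 𝕜 (Set.range (standardMonomial 𝕜 : PlanePartition a b c → _))
  simp only [standardMonomial, map_prod, substCols_selectDet, selectDet_sum_smul]
  rw [Finset.prod_univ_sum]
  refine Submodule.sum_mem _ fun f _ => ?_
  rw [Finset.prod_smul]
  exact Submodule.smul_mem _ _ (prod_selectDet_mem_span f)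

end PlanePartition

/-! ### The reversal and sign matrices -/

theorem Fin.sign_revPerm (n : ℕ) :
    Equiv.Perm.sign (Fin.revPerm : Equiv.Perm (Fin n)) = (-1) ^ ∑ r : Fin n, (r : ℕ) := by
  -- Every pair is an inversion; reindexing by reversal turns the count n - 1 - i into i.
  rw [Equiv.Perm.sign_eq_prod_prod_Ioi, ← Equiv.sum_comp Fin.revPerm, ← Finset.prod_pow_eq_pow_sum]
  refine Finset.prod_congr rfl fun i _ => ?_
  rw [Finset.prod_congr rfl (g := fun _ => (-1 : ℤˣ)), Finset.prod_const, Fin.card_Ioi]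
  · congr 1
    simp only [Fin.revPerm_apply, Fin.val_rev]
    omega
  · intro j hj
    rw [if_neg]
    simpa using (mem_Ioi.1 hj).le

/-- The matrix that reverses the order of the columns. -/
def reversalMatrix (𝕜 : Type*) [CommRing 𝕜] (N : ℕ) : Matrix (Fin N) (Fin N) 𝕜 :=
  fun l j => if l = j.rev then 1 else 0

/-- The matrix that negates every other column. -/
def signMatrix (𝕜 : Type*) [CommRing 𝕜] (N : ℕ) : Matrix (Fin N) (Fin N) 𝕜 :=
  Matrix.diagonal fun j => (-1) ^ (j : ℕ)

namespace PlanePartition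

variable {a b c : ℕ} {𝕜 : Type*} [CommRing 𝕜]

/-- Reversing the columns leaves the entries of each minor in decreasing order; restoring the order
costs one sign per factor. The order of the factors is immaterial. -/
theorem standardMonomial_complement (T : PlanePartition a b c) :
    standardMonomial 𝕜 T.complement =
      (((-1) ^ ∑ r : Fin a, (r : ℕ)) ^ c : 𝕜) •
        substCols (reversalMatrix 𝕜 (a + b)) (standardMonomial 𝕜 T) := by
  have h1 : ∀ I : Fin a → Fin (a + b), substCols (reversalMatrix 𝕜 (a + b))
      (selectDet (genericCol 𝕜) I) = selectDet (genericCol 𝕜) (Fin.rev ∘ I) := by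
    intro I
    rw [substCols_selectDet]
    simp only [reversalMatrix, ite_smul, one_smul, zero_smul, Finset.sum_ite_eq', mem_univ,
      if_true]
    rfl
  have h2 : ∀ k, selectDet (genericCol 𝕜) (T.complement.seq k) =
      ((-1) ^ ∑ r : Fin a, (r : ℕ) : 𝕜) •
        selectDet (genericCol 𝕜) (Fin.rev ∘ T.seq (Fin.revPerm k)) := by
    intro k
    have := selectDet_comp_perm (genericCol 𝕜) (Fin.rev ∘ T.seq k.rev) Fin.revPerm
    rw [Fin.sign_revPerm] at this
    rw [seq_complement, ← Function.comp_assoc]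
    refine this.trans ?_
    rcases Nat.even_or_odd (∑ r : Fin a, (r : ℕ)) with h | h
    · rw [h.neg_one_pow (α := ℤˣ), h.neg_one_pow (α := 𝕜)]
      simp
    · rw [h.neg_one_pow (α := ℤˣ), h.neg_one_pow (α := 𝕜)]
      simp
  simp only [standardMonomial, map_prod, h1, h2]
  rw [Finset.prod_smul, Finset.prod_const, Finset.card_univ, Fintype.card_fin,
    Equiv.prod_comp Fin.revPerm fun k => selectDet (genericCol 𝕜) (Fin.rev ∘ T.seq k)]

/-- The entries of `T.seq k` sum to Σ r plus the heights in layer `k`, and all the heights together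
sum to |T|. -/
theorem substCols_signMatrix_standardMonomial (T : PlanePartition a b c) :
    substCols (signMatrix 𝕜 (a + b)) (standardMonomial 𝕜 T) =
      (((-1) ^ ∑ r : Fin a, (r : ℕ)) ^ c * (-1) ^ T.size : 𝕜) • standardMonomial 𝕜 T := by
  have h1 : ∀ k, substCols (signMatrix 𝕜 (a + b)) (selectDet (genericCol 𝕜) (T.seq k)) =
      ((-1) ^ (∑ r : Fin a, (r : ℕ)) * (-1) ^ ∑ i, T.height i k : 𝕜) •
        selectDet (genericCol 𝕜) (T.seq k) := by
    intro k
    rw [substCols_selectDet]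
    have : (fun j : Fin (a + b) => ∑ l, signMatrix 𝕜 (a + b) l j • genericCol 𝕜 (a := a) l) =
        fun j : Fin (a + b) => ((-1) ^ (j : ℕ) : 𝕜) • genericCol 𝕜 j := by
      funext j
      simp [signMatrix, Matrix.diagonal_apply, ite_smul]
    rw [this, selectDet_smul, Finset.prod_pow_eq_pow_sum, ← pow_add]
    simp only [seq, Finset.sum_add_distrib]
    rw [← Equiv.sum_comp Fin.revPerm fun i => T.height i k]
    rfl
  simp only [standardMonomial, map_prod, h1]
  rw [Finset.prod_smul, Finset.prod_mul_distrib, Finset.prod_const, Finset.card_univ,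
    Fintype.card_fin, Finset.prod_pow_eq_pow_sum, size_eq_sum_height]

end PlanePartition

/-- The reversal matrix is conjugate to the diagonal matrix of alternating signs. -/
theorem exists_signMatrix_mul_eq {𝕜 : Type*} [Field 𝕜] (h2 : (2 : 𝕜) ≠ 0) (N : ℕ) :
    ∃ P : Matrix (Fin N) (Fin N) 𝕜, IsUnit P ∧
      signMatrix 𝕜 N * P = P * reversalMatrix 𝕜 N := by
  -- Row 2j of `P` is e_j + e_{rev j} and row 2j + 1 is e_j - e_{rev j}: left eigenvectors of the
  -- reversal with eigenvalue (-1)^i. For odd N the middle index gives the row 2e_j.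
  let ρ : Fin N → Fin N := fun i => if Even (i : ℕ) then ⟨i / 2, by omega⟩
    else Fin.rev ⟨i / 2, by omega⟩
  let P : Matrix (Fin N) (Fin N) 𝕜 := Matrix.of fun i l =>
    (if l = ρ i then (-1) ^ (i : ℕ) else 0) + if l = (ρ i).rev then 1 else 0
  have hPa : ∀ i l, P i l =
      (if l = ρ i then (-1) ^ (i : ℕ) else 0) + if l = (ρ i).rev then 1 else 0 := fun _ _ => rfl
  have hP : ∀ (w : Fin N → 𝕜) (i : Fin N),
      P.mulVec w i = (-1) ^ (i : ℕ) * w (ρ i) + w (ρ i).rev := by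
    intro w i
    simp [Matrix.mulVec, dotProduct, hPa, add_mul, Finset.sum_add_distrib]
  refine ⟨P, ?_, ?_⟩
  · rw [Matrix.isUnit_iff_isUnit_det, isUnit_iff_ne_zero]
    intro hdet
    obtain ⟨w, hw, hPw⟩ := Matrix.exists_mulVec_eq_zero_iff.2 hdet
    have heven : ∀ j : Fin N, 2 * (j : ℕ) < N → w j + w j.rev = 0 := by
      intro j hj
      have h := congrFun hPw ⟨2 * j, hj⟩
      have hρ : ρ ⟨2 * j, hj⟩ = j := by simp [ρ]
      rw [hP, hρ] at h
      simpa using h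
    have hodd : ∀ j : Fin N, N ≤ 2 * (j : ℕ) → w j.rev = w j := by
      intro j hj
      have hlt : 2 * (j.rev : ℕ) + 1 < N := by rw [Fin.val_rev]; omega
      have h := congrFun hPw ⟨2 * j.rev + 1, hlt⟩
      have hρ : ρ ⟨2 * j.rev + 1, hlt⟩ = j := by
        have : ¬ Even (2 * (j.rev : ℕ) + 1) := by simp
        simp only [ρ, if_neg this]
        rw [Fin.rev_eq_iff]
        apply Fin.ext
        simp only
        omega
      rw [hP, hρ] at h
      have hs : (-1 : 𝕜) ^ (2 * (j.rev : ℕ) + 1) = -1 := by rw [pow_succ, pow_mul]; simp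
      simp only [hs, Pi.zero_apply] at h
      linear_combination h
    apply hw
    have hsmall : ∀ j : Fin N, 2 * (j : ℕ) < N → w j = 0 := by
      intro j hj
      have h1 := heven j hj
      have h3 : w j.rev = w j := by
        by_cases h : N ≤ 2 * (j.rev : ℕ)
        · have := hodd j.rev h
          rw [Fin.rev_rev] at this
          exact this.symm
        · have : j.rev = j := by
            apply Fin.ext
            rw [Fin.val_rev] at h ⊢
            omega
          rw [this]
      rw [h3, ← two_mul] at h1
      exact (mul_eq_zero.1 h1).resolve_left h2
    funext j
    by_cases h : 2 * (j : ℕ) < N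
    · exact hsmall j h
    · rw [← hodd j (not_lt.1 h)]
      exact hsmall _ (by rw [Fin.val_rev]; omega)
  · ext i l
    rw [signMatrix, Matrix.diagonal_mul]
    simp only [Matrix.mul_apply, reversalMatrix, mul_ite, mul_one, mul_zero, Finset.sum_ite_eq',
      mem_univ, if_true, hPa, Fin.rev_inj, mul_add]
    rw [← pow_add, Even.neg_one_pow ⟨_, rfl⟩, add_comm]
    simp only [Fin.rev_eq_iff]

/-! ### Transport of the conjugation to `V` -/

/-- Two endomorphisms of `V` are conjugate if they are intertwined, along an embedding of `V`, by
an automorphism that preserves the image of `V`. -/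
theorem exists_linearEquiv_conj {𝕜 V M : Type*} [CommRing 𝕜] [AddCommGroup V] [Module 𝕜 V]
    [AddCommGroup M] [Module 𝕜 M] (L : V →ₗ[𝕜] M) (hL : Function.Injective L) (p q : M →ₗ[𝕜] M)
    (hp : ∀ x, p (L x) ∈ LinearMap.range L) (hq : ∀ x, q (L x) ∈ LinearMap.range L)
    (hpq : ∀ y, p (q y) = y) (hqp : ∀ y, q (p y) = y) (A D : V →ₗ[𝕜] V)
    (h : ∀ x y, p (L x) = L y → p (L (A x)) = L (D y)) :
    ∃ g : V ≃ₗ[𝕜] V,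
      (g : V →ₗ[𝕜] V) ∘ₗ A ∘ₗ (g.symm : V →ₗ[𝕜] V) = D := by
  let e := LinearEquiv.ofInjective L hL
  have lift : ∀ r : M →ₗ[𝕜] M, (∀ x, r (L x) ∈ LinearMap.range L) →
      ∃ r' : V →ₗ[𝕜] V, ∀ x, L (r' x) = r (L x) := by
    intro r hr
    refine ⟨e.symm.toLinearMap ∘ₗ (r ∘ₗ L).codRestrict _ hr, fun x => ?_⟩
    have := congrArg Subtype.val (e.apply_symm_apply ((r ∘ₗ L).codRestrict _ hr x))
    exact this
  obtain ⟨p', hp'⟩ := lift p hp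
  obtain ⟨q', hq'⟩ := lift q hq
  have h1 : ∀ x, p' (q' x) = x := fun x => hL (by rw [hp', hq', hpq])
  have h2 : ∀ x, q' (p' x) = x := fun x => hL (by rw [hq', hp', hqp])
  refine ⟨LinearEquiv.ofLinearMap p' q' (LinearMap.ext h1) (LinearMap.ext h2), ?_⟩
  ext y
  refine hL ?_
  change L (p' (A (q' y))) = L (D y)
  rw [hp']
  exact h _ _ (by rw [hq', hpq])

theorem mainTheorem1 (a b c : ℕ) {𝕜 V : Type*} [Field 𝕜] (h2 : (2 : 𝕜) ≠ 0)
    [AddCommGroup V] [Module 𝕜 V] (B : Module.Basis (PlanePartition a b c) 𝕜 V) :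
    ∃ g : V ≃ₗ[𝕜] V,
      (g : V →ₗ[𝕜] V) ∘ₗ PlanePartition.complementLinear B ∘ₗ (g.symm : V →ₗ[𝕜] V) =
        PlanePartition.negateOdd B := by
  obtain ⟨P, hP, hconj⟩ := exists_signMatrix_mul_eq h2 (a + b)
  obtain ⟨Q, hPQ, hQP⟩ := isUnit_iff_exists.1 hP
  let L : V →ₗ[𝕜] MvPolynomial (Fin a × Fin (a + b)) 𝕜 :=
    B.constr 𝕜 (PlanePartition.standardMonomial 𝕜)
  have hLB : ∀ T, L (B T) = PlanePartition.standardMonomial 𝕜 T :=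
    fun T => B.constr_basis 𝕜 _ T
  have hL : Function.Injective L := B.injective_constr_of_linearIndependent
    (PlanePartition.linearIndependent_standardMonomial 𝕜)
  have hrange : LinearMap.range L =
      Submodule.span 𝕜 (Set.range (PlanePartition.standardMonomial 𝕜)) := B.constr_range 𝕜
  have hmem : ∀ M x, (substCols M).toLinearMap (L x) ∈ LinearMap.range L := by
    intro M x
    have hx := LinearMap.mem_range_self L x
    rw [hrange] at hx ⊢
    exact PlanePartition.substCols_mem_span M hx
  have hinv : ∀ M M' : Matrix (Fin (a + b)) (Fin (a + b)) 𝕜, M * M' = 1 →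
      ∀ y : MvPolynomial (Fin a × Fin (a + b)) 𝕜, substCols M (substCols M' y) = y :=
    fun M M' h y => by rw [substCols_substCols, h, substCols_one]
  set s : 𝕜 := ((-1) ^ ∑ r : Fin a, (r : ℕ)) ^ c with hs
  have hss : s * s = 1 := by
    rw [hs, ← pow_mul, ← pow_add, Even.neg_one_pow ⟨_, rfl⟩]
  have hcompl : ∀ x, L (PlanePartition.complementLinear B x) =
      s • substCols (reversalMatrix 𝕜 (a + b)) (L x) := by
    suffices h : L ∘ₗ PlanePartition.complementLinear B =
        s • (substCols (reversalMatrix 𝕜 (a + b))).toLinearMap ∘ₗ L from DFunLike.congr_fun h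
    refine B.ext fun T => ?_
    simp only [LinearMap.comp_apply, LinearMap.smul_apply, AlgHom.toLinearMap_apply, hLB,
      PlanePartition.complementLinear, Module.Basis.constr_basis]
    exact PlanePartition.standardMonomial_complement T
  have hneg : ∀ x, L (PlanePartition.negateOdd B x) =
      s • substCols (signMatrix 𝕜 (a + b)) (L x) := by
    suffices h : L ∘ₗ PlanePartition.negateOdd B =
        s • (substCols (signMatrix 𝕜 (a + b))).toLinearMap ∘ₗ L from DFunLike.congr_fun h
    refine B.ext fun T => ?_
    simp only [LinearMap.comp_apply, LinearMap.smul_apply, AlgHom.toLinearMap_apply, hLB,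
      PlanePartition.negateOdd, Module.Basis.constr_basis]
    rw [PlanePartition.substCols_signMatrix_standardMonomial, smul_smul, ← mul_assoc, ← hs, hss,
      one_mul]
    split_ifs with h
    · rw [map_neg, hLB, h.neg_one_pow, neg_one_smul]
    · rw [hLB, (Nat.not_odd_iff_even.1 h).neg_one_pow, one_smul]
  refine exists_linearEquiv_conj L hL (substCols P).toLinearMap (substCols Q).toLinearMap
    (hmem P) (hmem Q) (hinv P Q hPQ) (hinv Q P hQP) _ _ fun x y hxy => ?_
  rw [AlgHom.toLinearMap_apply] at hxy ⊢
  -- The scalar `s` passes through, leaving the matrix identity `hconj`.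
  rw [hcompl, hneg, ← hxy, map_smul, substCols_substCols, substCols_substCols, hconj]
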